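/- Conventions. $\Sigma=\{0,1\}$. A function $F:\subseteq\Sigma^\omega\to\Sigma^\omega$ is computable if a Turing machine transforms every $p\in\operatorname{dom}F$, written on the input tape, into $F(p)$ on a one-way output tape. A representation of a set $X$ is a surjection $\delta:\subseteq\Sigma^\omega\to X$; a map $f:X\to Y$ is $(\delta,\delta')$-computable if there is a computable $F$ with $\delta'(F(p))=f(\delta(p))$ for all $p\in\operatorname{dom}\delta$. $\mathbb N$ is represented by $\delta_{\mathbb N}(1^n0^\omega)=n$, and a sequence in a represented space is computable if it is computable as a map on $\mathbb N$. For a metric space $X$ with a dense sequence $\alpha$, the Cauchy representation is $\delta_X(01^{n_0+1}01^{n_1+1}\cdots)=\lim_i\alpha(n_i)$, for convergent $(\alpha(n_i))_i$ with $d(\alpha(n_i),\alpha(n_j))<2^{-i}$ for all $j>i$; $\delta_{\mathbb R}$ is formed with a standard numbering of $\mathbb Q$. A computable Hilbert space is a Hilbert space $X$ over $\mathbb F\in\{\mathbb R,\mathbb C\}$ with a sequence $e:\mathbb N\to X$ of dense linear span such that, $\alpha_e$ being the standard numbering of the finite linear combinations of the $e_i$ with coefficients in $\mathbb Q$ (resp.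 $\mathbb Q[i]$), the double sequence $d(\alpha_e(m),\alpha_e(n))$ of real numbers is computable; it carries the Cauchy representation $\delta_X$ of $(X,d,\alpha_e)$. $[\delta\to\delta']$ denotes the standard representation of the continuous functions between represented spaces. Let $H$ and $H_i$ ($i\in\mathbb N$) be computable Hilbert spaces over $\mathbb F$, and for each $i$ let $(e_{ik})_{k\in\mathbb N}$ be an orthonormal basis of $H_i$ that is a computable sequence in $H_i$. Let $\bigoplus H_i=\{(f_i): f_i\in H_i,\ \sum_i\|f_i\|^2<\infty\}$ be the Hilbert space direct sum and let $E_{jk}\in\bigoplus H_i$ have $j$-th component $e_{jk}$ and all other components $0$. As a computable Hilbert space with fundamental sequence $(E_{jk})_{j,k}$, $\bigoplus H_i$ has a Cauchy representation. A second representation $\delta_{\bigoplus H_i}$ is defined by $\delta_{\bigoplus H_i}(\langle\langle p_0,p_1,\dots\rangle,q\rangle)=(f_i)$ iff $\delta_{H_i}(p_i)=f_i$ for all $i$ and $\delta_{\mathbb R}(q)=\sum_i\|f_i\|^2$. A sequence of bounded linear operators $\Lambda_i:H\to H_i$ is a g-frame if there are $0<A\le B<\infty$ with $A\|f\|^2\le\sum_i\|\Lambda_if\|^2\le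 B\|f\|^2$ for all $f\in H$; its analysis operator is $T^*:H\to\bigoplus H_i$, $T^*f=(\Lambda_if)_i$. It is a computable g-frame if moreover it is a computable sequence, i.e. from a $\delta_{\mathbb N}$-name of $i$ one can compute a $[\delta_H\to\delta_{H_i}]$-name of $\Lambda_i$. A computable dual g-frame of $(\Lambda_i)$ is a computable g-frame $(\Theta_i)$, $\Theta_i:H\to H_i$, with $f=\sum_i\Lambda_i^*\Theta_if$ for all $f\in H$. **Theorem.** Let $(\Lambda_i)$ be a computable g-frame for $H$ with respect to $(H_i)$, with analysis operator $T^*$. Let $\varphi:\bigoplus H_i\to H$ be a bounded linear operator with $\varphi T^*=\mathrm{id}_H$ that is computable with respect to the Cauchy representations of $\bigoplus H_i$ and $H$, and whose adjoint $\varphi^*:H\to\bigoplus H_i$ is $(\delta_H,\delta_{\bigoplus H_i})$-computable. Let $(\Gamma_i)$, $\Gamma_i:H\to H_i$, be a g-frame with $\Gamma_j^*(e_{jk})=\varphi(E_{jk})$ for all $j,k\in\mathbb N$. Then $(\Gamma_i)$ is a computable dual g-frame of $(\Lambda_i)$. -/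

import Mathlib

open scoped ENNReal

namespace CompGFrame

/-! ## Infinite words and computable functions on them -/

/-- The set `Σ^ω` of infinite words over the alphabet `Σ = {0, 1}`; `true` is the symbol `1`,
`false` is the symbol `0`. -/
abbrev InfWord : Type := ℕ → Bool

/-- The finite word `p(0) p(1) ⋯ p(n-1)`. -/
def InfWord.take (p : InfWord) (n : ℕ) : List Bool := (List.range n).map p

/-- The finite word `u` is an initial segment of the infinite word `p`. -/
def IsInitial (u : List Bool) (p : InfWord) : Prop := u = p.take u.length

/-- `h`, read as the function that sends the part of the input tape which is known so far to the
part of the (one-way) output tape which is written so far, transforms the infinite word `p` into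
the infinite word `q`. -/
def Transforms (h : List Bool → List Bool) (p q : InfWord) : Prop :=
  (∀ n, IsInitial (h (p.take n)) q) ∧ ∀ m, ∃ n, m ≤ (h (p.take n)).length

/-- Computability of a partial function `F :⊆ Σ^ω → Σ^ω`: a machine reads the input word letter by
letter and writes the output word letter by letter on a one-way tape, so that what has been
written is a computable and monotone function of what has been read; `F p` is the infinite word
written on input `p`, and it is undefined if only finitely many letters are ever written. -/
def Type2Computable (F : InfWord →. InfWord) : Prop :=
  ∃ h : List Bool → List Bool, Computable h ∧ (∀ u v, u <+: v → h u <+: h v) ∧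
    ∀ p q, q ∈ F p ↔ Transforms h p q

/-- The pairing `⟨p, q⟩ = p(0) q(0) p(1) q(1) ⋯` of infinite words. -/
def InfWord.pair (p q : InfWord) : InfWord :=
  fun n => if n % 2 = 0 then p (n / 2) else q (n / 2)

/-- The first component of `⟨p, q⟩`. -/
def InfWord.left (r : InfWord) : InfWord := fun n => r (2 * n)

/-- The second component of `⟨p, q⟩`. -/
def InfWord.right (r : InfWord) : InfWord := fun n => r (2 * n + 1)

/-- The countable tupling `⟨p₀, p₁, p₂, …⟩`, whose letter number `⟨i, j⟩` is `pᵢ(j)`. -/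
def InfWord.tuple (P : ℕ → InfWord) : InfWord := fun n => P n.unpair.1 n.unpair.2

/-- The component `pᵢ` of `⟨p₀, p₁, p₂, …⟩`. -/
def InfWord.component (r : InfWord) (i : ℕ) : InfWord := fun j => r (Nat.pair i j)

theorem InfWord.left_pair (p q : InfWord) : (InfWord.pair p q).left = p := by
  funext n
  simp [InfWord.pair, InfWord.left]

theorem InfWord.right_pair (p q : InfWord) : (InfWord.pair p q).right = q := by
  funext n
  have h1 : (2 * n + 1) % 2 = 1 := by omega
  have h2 : (2 * n + 1) / 2 = n := by omega
  simp [InfWord.pair, InfWord.right, h2]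

theorem InfWord.component_tuple (P : ℕ → InfWord) (i : ℕ) :
    (InfWord.tuple P).component i = P i := by
  funext n
  simp [InfWord.tuple, InfWord.component]

/-! ## Represented spaces -/

/-- A representation of `X`, i.e. a surjective partial function `δ :⊆ Σ^ω → X`, given by its graph:
`δ.IsName p x` says that `δ(p) = x`. -/
structure Representation (X : Type*) where
  IsName : InfWord → X → Prop
  unique : ∀ {p x y}, IsName p x → IsName p y → x = y
  surj : ∀ x, ∃ p, IsName p x

/-- `f` is `(δ, δ')`-computable: there is a computable `F :⊆ Σ^ω → Σ^ω` with
`δ' (F p) = f (δ p)` for all `p` in the domain of `f ∘ δ`. -/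
def ComputableMap {X Y : Type*} (δ : Representation X) (δ' : Representation Y) (f : X → Y) : Prop :=
  ∃ F : InfWord →. InfWord, Type2Computable F ∧
    ∀ p x, δ.IsName p x → ∃ q ∈ F p, δ'.IsName q (f x)

/-- The representation `δ_ℕ(1ⁿ0^ω) = n`. -/
def natRep : Representation ℕ where
  IsName p n := p = fun i => decide (i < n)
  unique {p x y} hx hy := by
    have h : ∀ i, i < x ↔ i < y := fun i => by
      have := congrFun (hx.symm.trans hy) i
      simpa using this
    have h1 := h x
    have h2 := h y
    omega
  surj n := ⟨_, rfl⟩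

/-- The representation `[δ, δ']` of a product: `[δ, δ']⟨p, q⟩ = (δ p, δ' q)`. -/
def Representation.prod {X Y : Type*} (δ : Representation X) (δ' : Representation Y) :
    Representation (X × Y) where
  IsName r z := δ.IsName r.left z.1 ∧ δ'.IsName r.right z.2
  unique hx hy := Prod.ext (δ.unique hx.1 hy.1) (δ'.unique hx.2 hy.2)
  surj z := by
    obtain ⟨p, hp⟩ := δ.surj z.1
    obtain ⟨q, hq⟩ := δ'.surj z.2
    exact ⟨InfWord.pair p q, by rwa [InfWord.left_pair], by rwa [InfWord.right_pair]⟩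

/-- A computable sequence in a represented space. -/
def ComputableSeq {X : Type*} (δ : Representation X) (f : ℕ → X) : Prop :=
  ComputableMap natRep δ f

/-! ## The Cauchy representation of a metric space with a dense sequence -/

/-- The position in `01^{s(0)+1}01^{s(1)+1}01^{s(2)+1}⋯` at which block number `k` starts. -/
def blockStart (s : ℕ → ℕ) (k : ℕ) : ℕ := ∑ i ∈ Finset.range k, (s i + 2)

open Classical in
/-- The infinite word `01^{s(0)+1}01^{s(1)+1}01^{s(2)+1}⋯`: the letter `0` stands exactly at the
starts of the blocks. -/
noncomputable def blocks (s : ℕ → ℕ) : InfWord := fun m => decide (∀ k, m ≠ blockStart s k)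

theorem blockStart_strictMono (s : ℕ → ℕ) : StrictMono (blockStart s) :=
  strictMono_nat_of_lt_succ fun k => by
    simp [blockStart, Finset.sum_range_succ]

theorem blocks_eq_false {s : ℕ → ℕ} {m : ℕ} : blocks s m = false ↔ ∃ k, blockStart s k = m := by
  simp [blocks, eq_comm]

theorem blockStart_congr {s t : ℕ → ℕ} {n : ℕ} (h : ∀ i < n, s i = t i) :
    blockStart s n = blockStart t n :=
  Finset.sum_congr rfl fun i hi => by rw [h i (Finset.mem_range.1 hi)]

/-- The entries `s(i)`, `i ≤ k`, are determined by the letters up to the start of block `k + 1`. -/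
theorem eq_of_blocks_agree {s t : ℕ → ℕ} {k : ℕ}
    (h : ∀ m ≤ blockStart s (k + 1), blocks s m = blocks t m) :
    ∀ i ≤ k, s i = t i := by
  intro i
  induction i using Nat.strong_induction_on with
  | _ i ih =>
    intro hi
    have h0 : blockStart s i = blockStart t i :=
      blockStart_congr fun j hj => ih j hj (by omega)
    have hs : blockStart s (i + 1) = blockStart s i + (s i + 2) := Finset.sum_range_succ _ _
    have ht : blockStart t (i + 1) = blockStart t i + (t i + 2) := Finset.sum_range_succ _ _
    have hle : blockStart s (i + 1) ≤ blockStart s (k + 1) :=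
      (blockStart_strictMono s).monotone (by omega)
    have h1 : ∃ a, blockStart t a = blockStart s (i + 1) := by
      rw [← blocks_eq_false, ← h _ hle, blocks_eq_false]
      exact ⟨_, rfl⟩
    obtain ⟨a, ha⟩ := h1
    have hia : i < a := (blockStart_strictMono t).lt_iff_lt.1 (by omega)
    have hta : blockStart t (i + 1) ≤ blockStart t a :=
      (blockStart_strictMono t).monotone hia
    have h2 : ∃ a, blockStart s a = blockStart t (i + 1) := by
      rw [← blocks_eq_false, h _ (by omega), blocks_eq_false]
      exact ⟨_, rfl⟩
    obtain ⟨c, hc⟩ := h2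
    have hic : i < c := (blockStart_strictMono s).lt_iff_lt.1 (by omega)
    have hsc : blockStart s (i + 1) ≤ blockStart s c :=
      (blockStart_strictMono s).monotone hic
    omega

theorem blocks_congr {s t : ℕ → ℕ} {n : ℕ} (h : ∀ i < n, s i = t i) :
    ∀ m < n, blocks s m = blocks t m := by
  have key : ∀ {s t : ℕ → ℕ}, (∀ i < n, s i = t i) → ∀ m < n,
      blocks s m = false → blocks t m = false := by
    intro s t h m hm hs
    rw [blocks_eq_false] at hs ⊢
    obtain ⟨k, hk⟩ := hs
    have : k ≤ blockStart s k := (blockStart_strictMono s).le_apply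
    exact ⟨k, by rw [← hk]; exact (blockStart_congr fun i hi => h i (by omega)).symm⟩
  intro m hm
  have h1 := key h m hm
  have h2 := key (fun i hi => (h i hi).symm) m hm
  cases hs : blocks s m <;> cases ht : blocks t m <;> simp_all

theorem blocks_injective : Function.Injective blocks := fun s t h => by
  funext i
  exact eq_of_blocks_agree (k := i) (fun m _ => by rw [h]) i le_rfl

/-- `δ_X(01^{s(0)+1}01^{s(1)+1}⋯) = x`: the points `α(s(i))` converge to `x`, and
`d(α(s(i)), α(s(j))) < 2^{-i}` for all `j > i`. -/
def CauchyName {X : Type*} [MetricSpace X] (α : ℕ → X) (p : InfWord) (x : X) : Prop :=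
  ∃ s : ℕ → ℕ, p = blocks s ∧ (∀ i j, i < j → dist (α (s i)) (α (s j)) < (1 / 2 : ℝ) ^ i) ∧
    Filter.Tendsto (fun i => α (s i)) Filter.atTop (nhds x)

theorem cauchyName_of_close {X : Type*} [MetricSpace X] {α : ℕ → X} {x : X} {s : ℕ → ℕ}
    (hs : ∀ i, dist (α (s i)) x < (1 / 2 : ℝ) ^ (i + 1)) : CauchyName α (blocks s) x := by
  refine ⟨s, rfl, fun i j hij => ?_, ?_⟩
  · have h1 := dist_triangle_right (α (s i)) (α (s j)) x
    have h2 : (1 / 2 : ℝ) ^ (j + 1) ≤ (1 / 2 : ℝ) ^ (i + 1) :=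
      pow_le_pow_of_le_one (by norm_num) (by norm_num) (by omega)
    have h3 : (1 / 2 : ℝ) ^ i = (1 / 2 : ℝ) ^ (i + 1) + (1 / 2 : ℝ) ^ (i + 1) := by ring
    have := hs i
    have := hs j
    linarith
  · rw [tendsto_iff_dist_tendsto_zero]
    have h0 : Filter.Tendsto (fun i : ℕ => (1 / 2 : ℝ) ^ (i + 1)) Filter.atTop (nhds 0) :=
      (tendsto_pow_atTop_nhds_zero_of_lt_one (by norm_num) (by norm_num)).comp
        (Filter.tendsto_add_atTop_nat 1)
    exact squeeze_zero (fun _ => dist_nonneg) (fun i => (hs i).le) h0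

/-- The Cauchy representation `δ_X` of a metric space `X` with dense sequence `α`. -/
def cauchyRep {X : Type*} [MetricSpace X] (α : ℕ → X) (hα : DenseRange α) : Representation X where
  IsName := CauchyName α
  unique := by
    rintro p x y ⟨s, hs, -, hx⟩ ⟨t, ht, -, hy⟩
    obtain rfl : s = t := blocks_injective (hs.symm.trans ht)
    exact tendsto_nhds_unique hx hy
  surj x := by
    have h : ∀ i : ℕ, ∃ n, dist (α n) x < (1 / 2 : ℝ) ^ (i + 1) := fun i => by
      obtain ⟨n, hn⟩ := hα.exists_dist_lt x (ε := (1 / 2 : ℝ) ^ (i + 1)) (by positivity)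
      exact ⟨n, by rwa [dist_comm]⟩
    choose s hs using h
    exact ⟨_, cauchyName_of_close hs⟩

/-! ## The representation of continuous functions -/

/-- The name `p` of a continuous partial function on `Σ^ω` is (the characteristic sequence of) a set
of pairs `(u, v)` of finite words. `EtaRel p q r` says that the function named by `p` sends `q` to
`r`: whenever `(u, v)` is listed and `u` is an initial segment of `q`, then `v` is one of `r`, and
arbitrarily long initial segments of `r` are obtained in this way. -/
def EtaRel (p q r : InfWord) : Prop :=
  (∀ u v : List Bool, p (Encodable.encode (u, v)) = true → IsInitial u q → IsInitial v r) ∧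
    ∀ m, ∃ u v : List Bool, p (Encodable.encode (u, v)) = true ∧ IsInitial u q ∧ m ≤ v.length

/-- `[δ → δ'](p) = f`: the function on `Σ^ω` named by `p` realizes `f`. -/
def FunName {X Y : Type*} (δ : Representation X) (δ' : Representation Y) (p : InfWord)
    (f : X → Y) : Prop :=
  ∀ q x, δ.IsName q x → ∃ r, EtaRel p q r ∧ δ'.IsName r (f x)

theorem IsInitial.apply_eq {u : List Bool} {p : InfWord} (h : IsInitial u p) {i : ℕ}
    (hi : i < u.length) : u[i]'hi = p i := by
  have h' : u[i]? = (p.take u.length)[i]? := congrArg (fun l : List Bool => l[i]?) h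
  simpa [InfWord.take, hi] using h'

theorem isInitial_take (p : InfWord) (n : ℕ) : IsInitial (p.take n) p := by
  simp [IsInitial, InfWord.take]

theorem isInitial_take_iff {p q : InfWord} {n : ℕ} :
    IsInitial (p.take n) q ↔ ∀ i < n, p i = q i := by
  simp [IsInitial, InfWord.take]

theorem EtaRel.unique {p q r r' : InfWord} (h : EtaRel p q r) (h' : EtaRel p q r') : r = r' := by
  funext i
  obtain ⟨u, v, huv, hu, hv⟩ := h.2 (i + 1)
  rw [← (h.1 u v huv hu).apply_eq (i := i) (by omega),
    ← (h'.1 u v huv hu).apply_eq (i := i) (by omega)]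

theorem FunName.unique {X Y : Type*} {δ : Representation X} {δ' : Representation Y} {p : InfWord}
    {f g : X → Y} (hf : FunName δ δ' p f) (hg : FunName δ δ' p g) : f = g := by
  funext x
  obtain ⟨q, hq⟩ := δ.surj x
  obtain ⟨r, hr, hr'⟩ := hf q x hq
  obtain ⟨t, ht, ht'⟩ := hg q x hq
  obtain rfl := hr.unique ht
  exact δ'.unique hr' ht'

/-- Every continuous function between metric spaces with dense sequences has a name. -/
theorem exists_funName {X Y : Type*} [MetricSpace X] [MetricSpace Y] {α : ℕ → X} {β : ℕ → Y}
    (hα : DenseRange α) (hβ : DenseRange β) {f : X → Y} (hf : Continuous f) :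
    ∃ p, FunName (cauchyRep α hα) (cauchyRep β hβ) p f := by
  classical
  let P : List Bool → ℕ → ℕ → Prop := fun u j m =>
    ∀ q x, CauchyName α q x → IsInitial u q → dist (β m) (f x) < (1 / 2 : ℝ) ^ (j + 1)
  have hex : ∀ q x, CauchyName α q x → ∀ j, ∃ n, ∃ m, P (q.take n) j m := by
    rintro q x ⟨s, rfl, hs, hx⟩ j
    obtain ⟨m, hm⟩ := hβ.exists_dist_lt (f x) (ε := (1 / 2 : ℝ) ^ (j + 1) / 2) (by positivity)
    obtain ⟨ε, hε, hball⟩ := Metric.continuous_iff.1 hf x ((1 / 2 : ℝ) ^ (j + 1) / 2)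
      (by positivity)
    obtain ⟨k, hk⟩ := exists_pow_lt_of_lt_one (half_pos hε) (by norm_num : (1 / 2 : ℝ) < 1)
    refine ⟨blockStart s (k + 1) + 1, m, ?_⟩
    rintro q' y ⟨t, rfl, ht, hy⟩ hinit
    rw [isInitial_take_iff] at hinit
    have hst : s k = t k :=
      eq_of_blocks_agree (k := k) (fun i hi => hinit i (by omega)) k le_rfl
    have hlim : ∀ (a : ℕ → ℕ) (z : X),
        (∀ i j, i < j → dist (α (a i)) (α (a j)) < (1 / 2 : ℝ) ^ i) →
        Filter.Tendsto (fun i => α (a i)) Filter.atTop (nhds z) →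
        dist (α (a k)) z ≤ (1 / 2 : ℝ) ^ k := by
      intro a z ha hz
      refine le_of_tendsto (tendsto_const_nhds.dist hz) ?_
      filter_upwards [Filter.eventually_gt_atTop k] with i hi
      exact (ha k i hi).le
    have h1 := hlim s x hs hx
    have h2 := hlim t y ht hy
    rw [← hst] at h2
    have h3 : dist y x < ε := by
      have := dist_triangle_left y x (α (s k))
      linarith
    have h4 := hball y h3
    have h5 := dist_triangle (β m) (f x) (f y)
    rw [dist_comm (β m) (f x), dist_comm (f x) (f y)] at h5
    linarith
  let N : InfWord → ℕ → ℕ := fun q j =>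
    if h : ∃ n, ∃ m, P (q.take n) j m then Nat.find h else 0
  let M : InfWord → ℕ → ℕ := fun q j =>
    if h : ∃ m, P (q.take (N q j)) j m then Nat.find h else 0
  have hN : ∀ q x, CauchyName α q x → ∀ j, (∃ m, P (q.take (N q j)) j m) ∧
      ∀ n < N q j, ¬ ∃ m, P (q.take n) j m := by
    intro q x hq j
    have h := hex q x hq j
    have e : N q j = Nat.find h := dif_pos h
    rw [e]
    exact ⟨Nat.find_spec h, fun n hn => Nat.find_min h hn⟩
  have hM : ∀ q x, CauchyName α q x → ∀ j, P (q.take (N q j)) j (M q j) := by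
    intro q x hq j
    have h := (hN q x hq j).1
    have e : M q j = Nat.find h := dif_pos h
    rw [e]
    exact Nat.find_spec h
  have htake : ∀ {q q' : InfWord} {n k : ℕ}, (∀ i < n, q i = q' i) → k ≤ n →
      q.take k = q'.take k := by
    intro q q' n k h hk
    refine List.map_congr_left fun i hi => h i ?_
    have := List.mem_range.1 hi
    omega
  have hloc : ∀ q x q' x', CauchyName α q x → CauchyName α q' x' → ∀ j,
      (∀ i < N q j, q i = q' i) → M q j = M q' j := by
    intro q x q' x' hq hq' j hagree
    have hNN : N q j = N q' j := by
      rcases lt_trichotomy (N q j) (N q' j) with h | h | h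
      · refine absurd ?_ ((hN q' x' hq' j).2 _ h)
        rw [← htake hagree le_rfl]
        exact (hN q x hq j).1
      · exact h
      · refine absurd ?_ ((hN q x hq j).2 _ h)
        rw [htake hagree h.le]
        exact (hN q' x' hq' j).1
    have e : q.take (N q j) = q'.take (N q' j) := by
      rw [← hNN]; exact htake hagree le_rfl
    simp only [M, e]
  refine ⟨fun c => decide (∃ u v : List Bool, c = Encodable.encode (u, v) ∧
    ∀ q x, CauchyName α q x → IsInitial u q → IsInitial v (blocks (M q))), ?_⟩
  intro q x hq
  have hq : CauchyName α q x := hq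
  refine ⟨blocks (M q), ⟨?_, ?_⟩, ?_⟩
  · intro u v huv hu
    obtain ⟨u', v', he, h⟩ := of_decide_eq_true huv
    obtain ⟨rfl, rfl⟩ := Prod.mk.inj (Encodable.encode_injective he)
    exact h q x hq hu
  · intro m
    refine ⟨q.take (∑ j ∈ Finset.range m, N q j), (blocks (M q)).take m,
      decide_eq_true ⟨_, _, rfl, ?_⟩, isInitial_take _ _, by simp [InfWord.take]⟩
    intro q' x' hq' hinit
    rw [isInitial_take_iff] at hinit ⊢
    refine blocks_congr fun j hj => hloc q x q' x' hq hq' j fun i hi => hinit i ?_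
    exact lt_of_lt_of_le hi
      (Finset.single_le_sum (f := fun j => N q j) (fun _ _ => Nat.zero_le _)
        (Finset.mem_range.2 hj))
  · exact cauchyName_of_close fun j => hM q x hq j q x hq (isInitial_take _ _)

/-! ## Computable Hilbert spaces -/

/-- The standard numbering `α_ℝ⟨⟨i, j⟩, k⟩ = (i - j) / (k + 1)` of the rational numbers in `ℝ`. -/
noncomputable def ratNum (n : ℕ) : ℝ :=
  ((n.unpair.1.unpair.1 : ℝ) - n.unpair.1.unpair.2) / (n.unpair.2 + 1)

theorem denseRange_ratNum : DenseRange ratNum := by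
  refine (Rat.denseRange_cast (𝕜 := ℝ)).mono ?_
  rintro _ ⟨q, rfl⟩
  refine ⟨Nat.pair (Nat.pair q.num.toNat (-q.num).toNat) (q.den - 1), ?_⟩
  have h1 : ((q.den - 1 : ℕ) : ℝ) + 1 = q.den := by
    have := q.den_pos
    rw [Nat.cast_sub this]; simp
  have h2 : ((q.num.toNat : ℕ) : ℝ) - ((-q.num).toNat : ℕ) = (q.num : ℝ) := by
    have := Int.toNat_sub_toNat_neg q.num
    exact_mod_cast congrArg (Int.cast : ℤ → ℝ) this
  simp only [ratNum, Nat.unpair_pair]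
  rw [h1, h2, Rat.cast_def]

/-- The real numbers with their Cauchy representation `δ_ℝ`. -/
noncomputable def realRep : Representation ℝ := cauchyRep ratNum denseRange_ratNum

/-- The standard numbering `α_𝔽` of the numbers `a + b i` with rational `a`, `b` in the scalar field;
for the real field `i` is `0` and these are just the rational numbers. -/
noncomputable def scalarNum (𝕜 : Type*) [RCLike 𝕜] (n : ℕ) : 𝕜 :=
  (ratNum n.unpair.1 : 𝕜) + (ratNum n.unpair.2 : 𝕜) * RCLike.I

theorem denseRange_scalarNum (𝕜 : Type*) [RCLike 𝕜] : DenseRange (scalarNum 𝕜) := by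
  have h1 : DenseRange (Prod.map ratNum ratNum) := denseRange_ratNum.prodMap denseRange_ratNum
  have hc : Continuous fun z : ℝ × ℝ => (z.1 : 𝕜) + (z.2 : 𝕜) * RCLike.I := by fun_prop
  have hs : Function.Surjective fun z : ℝ × ℝ => (z.1 : 𝕜) + (z.2 : 𝕜) * RCLike.I :=
    fun z => ⟨(RCLike.re z, RCLike.im z), RCLike.re_add_im z⟩
  refine (hs.denseRange.comp h1 hc).mono ?_
  rintro _ ⟨⟨a, b⟩, rfl⟩
  exact ⟨Nat.pair a b, by simp [scalarNum]⟩

/-- The numbering `α_e` of the finite linear combinations `∑_{i ≤ k} α_𝔽(nᵢ) eᵢ`: the number `n`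
codes the finite sequence `(n₀, …, n_k)` of coefficient indices. -/
noncomputable def linComb (𝕜 : Type*) [RCLike 𝕜] {X : Type*} [AddCommGroup X] [Module 𝕜 X]
    (e : ℕ → X) (n : ℕ) : X :=
  ∑ i : Fin (Denumerable.ofNat (List ℕ) n).length,
    scalarNum 𝕜 ((Denumerable.ofNat (List ℕ) n).get i) • e i

theorem denseRange_linComb (𝕜 : Type*) [RCLike 𝕜] {X : Type*} [NormedAddCommGroup X]
    [NormedSpace 𝕜 X] {e : ℕ → X} (he : Dense (Submodule.span 𝕜 (Set.range e) : Set X)) :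
    DenseRange (linComb 𝕜 e) := by
  refine dense_closure.1 (he.mono ?_)
  intro x hx
  obtain ⟨c, rfl⟩ := Finsupp.mem_span_range_iff_exists_finsupp.1 hx
  obtain ⟨n, hn⟩ : ∃ n, c.support ⊆ Finset.range n := c.support.exists_nat_subset_range
  have hsum : (c.sum fun i a => a • e i) = ∑ i : Fin n, c i • e i := by
    rw [Finsupp.sum_of_support_subset c hn _ (by simp), Finset.sum_range]
  rw [hsum]
  have hcont : Continuous fun a : Fin n → 𝕜 => ∑ i : Fin n, a i • e i := by fun_prop
  have hd : DenseRange (Pi.map (fun _ : Fin n => scalarNum 𝕜)) :=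
    DenseRange.piMap fun _ => denseRange_scalarNum 𝕜
  have hmem := hcont.range_subset_closure_image_dense hd
    (Set.mem_range_self (fun i : Fin n => c i))
  refine closure_mono ?_ hmem
  rintro _ ⟨_, ⟨a, rfl⟩, rfl⟩
  refine ⟨Encodable.encode (List.ofFn a), ?_⟩
  unfold linComb
  rw [Denumerable.ofNat_encode]
  refine Fintype.sum_equiv (finCongr (List.length_ofFn)) _ _ fun i => ?_
  simp
  rfl

/-- A computable Hilbert space: a Hilbert space together with a fundamental sequence `e` whose linear
span is dense and for which `(X, d, α_e)` is a computable metric space, i.e. the double sequence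
`d(α_e(m), α_e(n))` of real numbers is computable. -/
structure ComputableHilbertSpace (𝕜 : Type*) [RCLike 𝕜] (X : Type*) [NormedAddCommGroup X]
    [InnerProductSpace 𝕜 X] [CompleteSpace X] where
  fund : ℕ → X
  dense_span : Dense (Submodule.span 𝕜 (Set.range fund) : Set X)
  computable_dist : ComputableMap (natRep.prod natRep) realRep
    fun z => dist (linComb 𝕜 fund z.1) (linComb 𝕜 fund z.2)

/-- The Cauchy representation of a computable Hilbert space. -/
noncomputable def ComputableHilbertSpace.rep {𝕜 : Type*} [RCLike 𝕜] {X : Type*}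
    [NormedAddCommGroup X] [InnerProductSpace 𝕜 X] [CompleteSpace X]
    (cX : ComputableHilbertSpace 𝕜 X) : Representation X :=
  cauchyRep (linComb 𝕜 cX.fund) (denseRange_linComb 𝕜 cX.dense_span)

section GFrames

variable {𝕜 : Type*} [RCLike 𝕜]
  {H : Type*} [NormedAddCommGroup H] [InnerProductSpace 𝕜 H] [CompleteSpace H]
  {G : ℕ → Type*} [∀ i, NormedAddCommGroup (G i)] [∀ i, InnerProductSpace 𝕜 (G i)]
  [∀ i, CompleteSpace (G i)]

/-! ## The Hilbert space direct sum and its two representations -/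

/-- The vector `E_{ij}` of the Hilbert space direct sum: its component number `i` is `e_{ij}`, all
others are `0`. -/
noncomputable def sumBasis (e : ∀ i, HilbertBasis ℕ 𝕜 (G i)) (i j : ℕ) : lp G 2 :=
  lp.single 2 i (e i j)

theorem dense_span_sumBasis (e : ∀ i, HilbertBasis ℕ 𝕜 (G i)) :
    Dense (Submodule.span 𝕜 (Set.range fun n : ℕ => sumBasis e n.unpair.1 n.unpair.2) :
      Set (lp G 2)) := by
  rw [Submodule.dense_iff_topologicalClosure_eq_top, Submodule.topologicalClosure_eq_top_iff,
    Submodule.eq_bot_iff]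
  intro f hf
  rw [Submodule.mem_orthogonal] at hf
  ext i
  refine (e i).repr.map_eq_zero_iff.1 ?_
  ext j
  have h := hf (sumBasis e i j) (Submodule.subset_span ⟨Nat.pair i j, by simp⟩)
  rw [sumBasis, lp.inner_single_left] at h
  simpa [HilbertBasis.repr_apply_apply] using h

/-- The Cauchy representation of the Hilbert space direct sum with the fundamental sequence
`(E_{ij})`. -/
noncomputable def sumCauchyRep (e : ∀ i, HilbertBasis ℕ 𝕜 (G i)) : Representation (lp G 2) :=
  cauchyRep (linComb 𝕜 fun n : ℕ => sumBasis e n.unpair.1 n.unpair.2)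
    (denseRange_linComb 𝕜 (dense_span_sumBasis e))

/-- The representation `δ_⊕` of the Hilbert space direct sum: `⟨⟨p₀, p₁, …⟩, q⟩` is a name of `(fᵢ)` if
`pᵢ` is a name of `fᵢ` for every `i` and `q` is a name of the real number `∑ ‖fᵢ‖²`. -/
noncomputable def sumRep (cG : ∀ i, ComputableHilbertSpace 𝕜 (G i)) :
    Representation (lp G 2) where
  IsName r f := (∀ i, (cG i).rep.IsName (r.left.component i) (f i)) ∧
    realRep.IsName r.right (∑' i, ‖f i‖ ^ 2)
  unique hx hy := lp.ext (funext fun i => (cG i).rep.unique (hx.1 i) (hy.1 i))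
  surj f := by
    choose P hP using fun i => (cG i).rep.surj (f i)
    obtain ⟨q, hq⟩ := realRep.surj (∑' i, ‖f i‖ ^ 2)
    refine ⟨InfWord.pair (InfWord.tuple P) q, fun i => ?_, ?_⟩
    · rw [InfWord.left_pair, InfWord.component_tuple]
      exact hP i
    · rwa [InfWord.right_pair]

/-! ## g-frames -/

/-- The representation `δ*` of `L*(H) = ⋃ᵢ L(H, Hᵢ)`: `⟨p, q⟩` is a name of `f ∈ L(H, Hᵢ)` if
`p` is a name of `i` and `q` is a name of `f` as a continuous function from `H` to `Hᵢ`. -/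
noncomputable def opRep (cH : ComputableHilbertSpace 𝕜 H)
    (cG : ∀ i, ComputableHilbertSpace 𝕜 (G i)) : Representation (Σ i, H →L[𝕜] G i) where
  IsName r f := natRep.IsName r.left f.1 ∧ FunName cH.rep (cG f.1).rep r.right f.2
  unique := by
    rintro r ⟨i, f⟩ ⟨j, g⟩ ⟨hi, hf⟩ ⟨hj, hg⟩
    obtain rfl : i = j := natRep.unique hi hj
    obtain rfl : f = g := DFunLike.coe_injective (hf.unique hg)
    rfl
  surj := by
    rintro ⟨i, f⟩
    obtain ⟨p, hp⟩ := natRep.surj i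
    obtain ⟨q, hq⟩ := exists_funName (denseRange_linComb 𝕜 cH.dense_span)
      (denseRange_linComb 𝕜 (cG i).dense_span) f.continuous
    exact ⟨InfWord.pair p q, by rwa [InfWord.left_pair], by rw [InfWord.right_pair]; exact hq⟩

/-- `(Λᵢ)` is a g-frame for `H` with respect to `(Hᵢ)`. -/
def IsGFrame (Λ : ∀ i, H →L[𝕜] G i) : Prop :=
  ∃ A B : ℝ, 0 < A ∧ A ≤ B ∧ ∀ f : H, Summable (fun i => ‖Λ i f‖ ^ 2) ∧
    A * ‖f‖ ^ 2 ≤ ∑' i, ‖Λ i f‖ ^ 2 ∧ ∑' i, ‖Λ i f‖ ^ 2 ≤ B * ‖f‖ ^ 2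

/-- `(Λᵢ)` is a computable g-frame for `H` with respect to `(Hᵢ)`: it is a g-frame, and
`i ↦ Λᵢ ∈ L(H, Hᵢ)` is a computable sequence in `L*(H)`. -/
def IsComputableGFrame (cH : ComputableHilbertSpace 𝕜 H)
    (cG : ∀ i, ComputableHilbertSpace 𝕜 (G i)) (Λ : ∀ i, H →L[𝕜] G i) : Prop :=
  IsGFrame Λ ∧ ComputableSeq (opRep cH cG) fun i => ⟨i, Λ i⟩

set_option linter.unusedSectionVars false in
theorem IsGFrame.memℓp {Λ : ∀ i, H →L[𝕜] G i} (hΛ : IsGFrame Λ) (f : H) :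
    Memℓp (fun i => Λ i f) 2 := by
  obtain ⟨A, B, -, -, h⟩ := hΛ
  refine memℓp_gen ?_
  simpa using (h f).1

/-- The analysis operator `T* f = (Λᵢ f)ᵢ` of a g-frame. -/
noncomputable def analysisOp (Λ : ∀ i, H →L[𝕜] G i) (hΛ : IsGFrame Λ) : H →L[𝕜] lp G 2 :=
  LinearMap.mkContinuousOfExistsBound
    { toFun := fun f => ⟨fun i => Λ i f, hΛ.memℓp f⟩
      map_add' := fun f g => by ext i; simp; rfl
      map_smul' := fun c f => by ext i; simp }
    (by
      obtain ⟨A, B, hA, hAB, h⟩ := id hΛ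
      refine ⟨Real.sqrt B, fun f => ?_⟩
      refine abs_le_of_sq_le_sq' ?_ (by positivity) |>.2
      have h2 := lp.norm_rpow_eq_tsum (p := 2) (by norm_num)
        (⟨fun i => Λ i f, hΛ.memℓp f⟩ : lp G 2)
      simp only [ENNReal.toReal_ofNat, Real.rpow_ofNat] at h2
      rw [mul_pow, Real.sq_sqrt (by linarith)]
      exact h2.trans_le (h f).2.2)

/-- `(Θᵢ)` is a computable dual g-frame of `(Λᵢ)`: it is a computable g-frame and
`f = ∑ᵢ Λᵢ* Θᵢ f` for all `f`. -/
def IsComputableDualGFrame (cH : ComputableHilbertSpace 𝕜 H)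
    (cG : ∀ i, ComputableHilbertSpace 𝕜 (G i)) (Λ Θ : ∀ i, H →L[𝕜] G i) : Prop :=
  IsComputableGFrame cH cG Θ ∧
    ∀ f : H, HasSum (fun i => ContinuousLinearMap.adjoint (Λ i) (Θ i f)) f

end GFrames

end CompGFrame

/-!
The operators `Γⱼ` are the components of the adjoint of `φ`: testing against the orthonormal basis
`(e_{jk})ₖ` gives `Γⱼ f = (φ* f)ⱼ` (`apply_eq_adjoint_apply`). Both halves of the theorem follow from
this identity.

Duality: taking adjoints in `φ T* = id` gives `T φ* = id`, and the synthesis operator `T` sends the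
expansion `g = ∑ᵢ (…, 0, gᵢ, 0, …)` in the direct sum to `T g = ∑ᵢ Λᵢ* gᵢ`. With `g = φ* f` this is
`f = ∑ᵢ Λᵢ* Γᵢ f`.

Computability: a machine realizing `φ*` turns a name of `f` into a word `⟨⟨p₀, p₁, …⟩, q⟩` in which
`pᵢ` is a name of `Γᵢ f`. Hence the pairs `(u, v)` of finite words such that the machine, having
read `u`, has already written the letters `v` of the component `pᵢ` form a name of the function
`Γᵢ`. This set is decidable uniformly in `i` (`computable₂_componentFunName`), and a family of words
computable uniformly in `i` is a computable sequence (`ComputableSeq.of_computable₂`). Of the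
representation of the direct sum, only the components of a name are used here.
-/

namespace CompGFrame

/-! ### Machines and computable families of words -/

theorem InfWord.length_take (p : InfWord) (n : ℕ) : (p.take n).length = n := by
  simp [InfWord.take]

theorem InfWord.take_prefix_take (p : InfWord) {m n : ℕ} (h : m ≤ n) : p.take m <+: p.take n := by
  obtain ⟨k, rfl⟩ := Nat.exists_eq_add_of_le h
  exact ⟨(List.range k).map fun i => p (m + i), by
    simp [InfWord.take, List.range_add, Function.comp_def]⟩

theorem Transforms.unique {h : List Bool → List Bool} {p q q' : InfWord} (hq : Transforms h p q)
    (hq' : Transforms h p q') : q = q' := by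
  funext i
  obtain ⟨n, hn⟩ := hq.2 (i + 1)
  rw [← (hq.1 n).apply_eq (i := i) hn, ← (hq'.1 n).apply_eq (i := i) hn]

/-- The partial function on infinite words that is carried out by `h`. -/
noncomputable def machineFun (h : List Bool → List Bool) : InfWord →. InfWord :=
  fun p => ⟨∃ q, Transforms h p q, fun hq => hq.choose⟩

theorem mem_machineFun {h : List Bool → List Bool} {p q : InfWord} :
    q ∈ machineFun h p ↔ Transforms h p q := by
  constructor
  · rintro ⟨hq, rfl⟩
    exact hq.choose_spec
  · intro hq
    exact ⟨⟨q, hq⟩, (Exists.choose_spec (⟨q, hq⟩ : ∃ q, Transforms h p q)).unique hq⟩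

theorem computable₂_take {r : ℕ → InfWord} (hr : Computable₂ r) :
    Computable₂ fun i n => (r i).take n := by
  have h : Computable fun z : ℕ × ℕ => Nat.rec (motive := fun _ => List Bool) []
      (fun y l => l ++ [r z.1 y]) z.2 := by
    refine Computable.nat_rec (h := fun (z : ℕ × ℕ) (w : ℕ × List Bool) => w.2 ++ [r z.1 w.1])
      Computable.snd (Computable.const []) ?_
    exact Computable.list_concat.comp (Computable.snd.comp Computable.snd)
      (hr.comp (Computable.fst.comp Computable.fst) (Computable.fst.comp Computable.snd))
  refine h.of_eq ?_
  rintro ⟨i, n⟩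
  induction n with
  | zero => rfl
  | succ n ih => simpa [InfWord.take, List.range_succ] using ih

/-- The length of output that may be written after reading `w`, which is to be an initial segment
of a name of a natural number: nothing before that number is known, i.e. before the first `0`, and
one letter per letter read from then on. -/
def outputLength (w : List Bool) : ℕ := if w.idxOf false < w.length then w.length else 0

theorem computable_outputLength : Computable outputLength := by
  refine Primrec.to_comp ?_
  exact Primrec.ite (Primrec.nat_lt.comp (Primrec.list_idxOf.comp (Primrec.const false) Primrec.id)
    Primrec.list_length) Primrec.list_length (Primrec.const 0)

theorem idxOf_false_take_nat (n m : ℕ) :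
    (InfWord.take (fun i => decide (i < n)) m).idxOf false = min n m := by
  induction m with
  | zero => simp [InfWord.take]
  | succ m ih =>
    have hs : InfWord.take (fun i => decide (i < n)) (m + 1) =
        InfWord.take (fun i => decide (i < n)) m ++ [decide (m < n)] := by
      simp [InfWord.take, List.range_succ]
    rw [hs, List.idxOf_append]
    simp only [← List.idxOf_lt_length_iff, ih, InfWord.length_take]
    by_cases h : m < n
    · rw [if_neg (by omega)]
      simp [h]
      omega
    · by_cases h' : n < m
      · rw [if_pos (by omega)]
        omega
      · rw [if_neg (by omega)]
        simp [h]
        omega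

theorem ComputableSeq.of_computable₂ {X : Type*} {δ : Representation X} {f : ℕ → X}
    {r : ℕ → InfWord} (hr : Computable₂ r) (hrf : ∀ i, δ.IsName (r i) (f i)) :
    ComputableSeq δ f := by
  let h : List Bool → List Bool := fun w => (r (w.idxOf false)).take (outputLength w)
  refine ⟨machineFun h, ⟨h, ?_, ?_, fun _ _ => mem_machineFun⟩, ?_⟩
  · exact (computable₂_take hr).comp
      (Primrec.list_idxOf.comp (Primrec.const false) Primrec.id).to_comp computable_outputLength
  · rintro u _ ⟨t, rfl⟩
    by_cases hu : u.idxOf false < u.length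
    · have hi : (u ++ t).idxOf false = u.idxOf false :=
        List.idxOf_append_of_mem (List.idxOf_lt_length_iff.1 hu)
      simp only [h, hi]
      refine InfWord.take_prefix_take _ ?_
      simp only [outputLength, hi, List.length_append]
      split_ifs <;> omega
    · simp [h, outputLength, hu, InfWord.take]
  · rintro p n hp
    have hp : p = fun i => decide (i < n) := hp
    subst hp
    refine ⟨r n, mem_machineFun.2 ⟨fun m => ?_, fun m => ⟨n + m + 1, ?_⟩⟩, hrf n⟩
    · simp only [h, outputLength, idxOf_false_take_nat, InfWord.length_take]
      split_ifs with hm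
      · rw [min_eq_left (by omega)]
        exact isInitial_take _ _
      · simp [IsInitial, InfWord.take]
    · simp only [h, outputLength, idxOf_false_take_nat, InfWord.length_take]
      rw [if_pos (by omega)]
      omega

/-! ### Names of the components of a realized function -/

/-- If `h` carries out a function with values `⟨⟨p₀, p₁, …⟩, q⟩`, this is a name, as a continuous
function on infinite words, of its component `pᵢ`: it lists the pairs `(u, v)` such that the letters
of `v` occur in `h u` at the places where `⟨⟨p₀, p₁, …⟩, q⟩` holds the first letters of `pᵢ`. -/
def componentFunName (h : List Bool → List Bool) (i : ℕ) : InfWord := fun c =>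
  ((Encodable.decode c : Option (List Bool × List Bool)).map fun z =>
    decide (z.2.map some = (List.range z.2.length).map fun j => (h z.1)[2 * Nat.pair i j]?)).getD
      false

theorem componentFunName_encode {h : List Bool → List Bool} {i : ℕ} {u v : List Bool} :
    componentFunName h i (Encodable.encode (u, v)) = true ↔
      ∀ j (hj : j < v.length), (h u)[2 * Nat.pair i j]? = some v[j] := by
  have hv : v.map some = (List.range v.length).map fun j => v[j]? :=
    List.ext_getElem? fun j => by
      by_cases hj : j < v.length <;> simp [hj]
  simp only [componentFunName, Encodable.encodek, Option.map_some, Option.getD_some,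
    decide_eq_true_iff]
  rw [hv, List.map_inj_left]
  refine forall_congr' fun j => ?_
  rw [List.mem_range]
  refine forall_congr' fun hj => ?_
  rw [List.getElem?_eq_getElem hj, eq_comm]

theorem computable₂_componentFunName {h : List Bool → List Bool} (hh : Computable h) :
    Computable₂ (componentFunName h) := by
  -- The test is primitive recursive once the output `h u` is given as data.
  have htest : Primrec fun z : (ℕ × List Bool) × List Bool =>
      decide (z.2.map some = (List.range z.2.length).map fun j => z.1.2[2 * Nat.pair z.1.1 j]?) := by
    refine PrimrecPred.decide (Primrec.eq.comp ?_ ?_)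
    · exact Primrec.list_map Primrec.snd (Primrec.option_some.comp Primrec.snd).to₂
    · refine Primrec.list_map (Primrec.list_range.comp (Primrec.list_length.comp Primrec.snd)) ?_
      exact Primrec.list_getElem?.comp (Primrec.snd.comp (Primrec.fst.comp Primrec.fst))
        (Primrec.nat_double.comp (Primrec₂.natPair.comp
          (Primrec.fst.comp (Primrec.fst.comp Primrec.fst)) Primrec.snd))
  have hcomp : Computable fun z : (ℕ × ℕ) × List Bool × List Bool => ((z.1.1, h z.2.1), z.2.2) :=
    ((Computable.fst.comp Computable.fst).pair
      (hh.comp (Computable.fst.comp Computable.snd))).pair (Computable.snd.comp Computable.snd)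
  have hdec : Computable fun z : ℕ × ℕ =>
      (Encodable.decode z.2 : Option (List Bool × List Bool)) :=
    Computable.decode.comp Computable.snd
  exact Computable.option_getD (Computable.option_map hdec (htest.to_comp.comp hcomp).to₂)
    (Computable.const false)

theorem etaRel_componentFunName {h : List Bool → List Bool} {q Q : InfWord}
    (hQ : Transforms h q Q) (i : ℕ) :
    EtaRel (componentFunName h i) q (Q.left.component i) := by
  refine ⟨fun u v huv hu => ?_, fun m => ?_⟩
  · rw [componentFunName_encode] at huv
    refine List.ext_getElem (by simp [InfWord.length_take]) fun j hj _ => ?_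
    have hinit : IsInitial (h u) Q := by
      rw [hu]
      exact hQ.1 _
    obtain ⟨hlt, heq⟩ := List.getElem?_eq_some_iff.1 (huv j hj)
    rw [← heq, hinit.apply_eq]
    simp [InfWord.take, InfWord.component, InfWord.left]
  · obtain ⟨n, hn⟩ := hQ.2 (2 * Nat.pair i m)
    refine ⟨q.take n, (Q.left.component i).take m, componentFunName_encode.2 fun j hj => ?_,
      isInitial_take _ _, (InfWord.length_take _ _).ge⟩
    rw [InfWord.length_take] at hj
    have := Nat.pair_lt_pair_right i hj
    rw [List.getElem?_eq_getElem (by omega), (hQ.1 n).apply_eq]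
    simp [InfWord.take, InfWord.component, InfWord.left]

theorem computable₂_pair_nat {r : ℕ → InfWord} (hr : Computable₂ r) :
    Computable₂ fun i => InfWord.pair (fun j => decide (j < i)) (r i) := by
  have hdiv : Primrec fun z : ℕ × ℕ => z.2 / 2 :=
    Primrec.nat_div.comp Primrec.snd (Primrec.const 2)
  have hmod : Primrec fun z : ℕ × ℕ => decide (z.2 % 2 = 0) :=
    PrimrecPred.decide (Primrec.eq.comp (Primrec.nat_mod.comp Primrec.snd (Primrec.const 2))
      (Primrec.const 0))
  have hlt : Primrec fun z : ℕ × ℕ => decide (z.2 / 2 < z.1) :=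
    PrimrecPred.decide (Primrec.nat_lt.comp hdiv Primrec.fst)
  refine (Computable.cond hmod.to_comp hlt.to_comp
    (hr.comp Computable.fst hdiv.to_comp)).of_eq fun z => ?_
  simp only [InfWord.pair, Bool.cond_decide]

section GFrames

variable {𝕜 : Type*} [RCLike 𝕜]
  {H : Type*} [NormedAddCommGroup H] [InnerProductSpace 𝕜 H] [CompleteSpace H]
  {G : ℕ → Type*} [∀ i, NormedAddCommGroup (G i)] [∀ i, InnerProductSpace 𝕜 (G i)]
  [∀ i, CompleteSpace (G i)]

/-- The components of a computable map into the direct sum form a computable sequence of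
operators. -/
theorem computableSeq_opRep_of_components {cH : ComputableHilbertSpace 𝕜 H}
    {cG : ∀ i, ComputableHilbertSpace 𝕜 (G i)} {S : H → lp G 2}
    (hS : ComputableMap cH.rep (sumRep cG) S)
    {Γ : ∀ i, H →L[𝕜] G i} (hΓ : ∀ i f, Γ i f = S f i) :
    ComputableSeq (opRep cH cG) fun i => ⟨i, Γ i⟩ := by
  obtain ⟨F, ⟨h, hh, -, hF⟩, hFS⟩ := hS
  refine ComputableSeq.of_computable₂ (computable₂_pair_nat (computable₂_componentFunName hh))
    fun i => ⟨?_, ?_⟩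
  · rw [InfWord.left_pair]
    rfl
  · rw [InfWord.right_pair]
    intro q x hq
    obtain ⟨Q, hQ, hQname⟩ := hFS q x hq
    refine ⟨_, etaRel_componentFunName ((hF q Q).1 hQ) i, ?_⟩
    rw [hΓ]
    exact hQname.1 i

/-! ### The dual g-frame given by a left inverse of the analysis operator -/

theorem apply_eq_adjoint_apply {e : ∀ i, HilbertBasis ℕ 𝕜 (G i)} {Γ : ∀ i, H →L[𝕜] G i}
    {φ : lp G 2 →L[𝕜] H}
    (hΓφ : ∀ j k, ContinuousLinearMap.adjoint (Γ j) (e j k) = φ (sumBasis e j k)) (j : ℕ) (f : H) :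
    Γ j f = ContinuousLinearMap.adjoint φ f j := by
  refine (e j).repr.injective (lp.ext (funext fun k => ?_))
  rw [HilbertBasis.repr_apply_apply, HilbertBasis.repr_apply_apply,
    ← ContinuousLinearMap.adjoint_inner_left, hΓφ, ← lp.inner_single_left,
    ContinuousLinearMap.adjoint_inner_right]
  rfl

theorem adjoint_analysisOp_single {Λ : ∀ i, H →L[𝕜] G i} (hΛ : IsGFrame Λ) (i : ℕ) (g : G i) :
    ContinuousLinearMap.adjoint (analysisOp Λ hΛ) (lp.single 2 i g) =
      ContinuousLinearMap.adjoint (Λ i) g := by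
  refine ext_inner_right 𝕜 fun f => ?_
  rw [ContinuousLinearMap.adjoint_inner_left, ContinuousLinearMap.adjoint_inner_left,
    lp.inner_single_left]
  rfl

theorem hasSum_adjoint_analysisOp {Λ : ∀ i, H →L[𝕜] G i} (hΛ : IsGFrame Λ) (g : lp G 2) :
    HasSum (fun i => ContinuousLinearMap.adjoint (Λ i) (g i))
      (ContinuousLinearMap.adjoint (analysisOp Λ hΛ) g) := by
  simpa [Function.comp_def, adjoint_analysisOp_single] using
    (ContinuousLinearMap.adjoint (analysisOp Λ hΛ)).hasSum
      (lp.hasSum_single (p := 2) (by norm_num) g)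

end GFrames

end CompGFrame

theorem theorem3p19 {𝕜 : Type*} [RCLike 𝕜]
    {H : Type*} [NormedAddCommGroup H] [InnerProductSpace 𝕜 H] [CompleteSpace H]
    {G : ℕ → Type*} [∀ i, NormedAddCommGroup (G i)] [∀ i, InnerProductSpace 𝕜 (G i)]
    [∀ i, CompleteSpace (G i)]
    (cH : CompGFrame.ComputableHilbertSpace 𝕜 H)
    (cG : ∀ i, CompGFrame.ComputableHilbertSpace 𝕜 (G i))
    (e : ∀ i, HilbertBasis ℕ 𝕜 (G i))
    (he : ∀ i, CompGFrame.ComputableSeq (cG i).rep (fun k => e i k))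
    (Λ : ∀ i, H →L[𝕜] G i) (hΛ : CompGFrame.IsComputableGFrame cH cG Λ)
    (Γ : ∀ i, H →L[𝕜] G i) (hΓ : CompGFrame.IsGFrame Γ)
    (φ : lp G 2 →L[𝕜] H)
    (hφ : CompGFrame.ComputableMap (CompGFrame.sumCauchyRep e) cH.rep φ)
    (hφleft : ∀ f : H, φ (CompGFrame.analysisOp Λ hΛ.1 f) = f)
    (hφadj : CompGFrame.ComputableMap cH.rep (CompGFrame.sumRep cG)
      (ContinuousLinearMap.adjoint φ))
    (hΓφ : ∀ j k, ContinuousLinearMap.adjoint (Γ j) (e j k) = φ (CompGFrame.sumBasis e j k)) :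
    CompGFrame.IsComputableDualGFrame cH cG Λ Γ := by
  have hΓ_apply := CompGFrame.apply_eq_adjoint_apply hΓφ
  refine ⟨⟨hΓ, CompGFrame.computableSeq_opRep_of_components hφadj hΓ_apply⟩, fun f => ?_⟩
  have hinv : ContinuousLinearMap.adjoint (CompGFrame.analysisOp Λ hΛ.1)
      (ContinuousLinearMap.adjoint φ f) = f := by
    refine ext_inner_right 𝕜 fun g => ?_
    rw [ContinuousLinearMap.adjoint_inner_left, ContinuousLinearMap.adjoint_inner_left, hφleft]
  simpa only [hΓ_apply, hinv] using
    CompGFrame.hasSum_adjoint_analysisOp hΛ.1 (ContinuousLinearMap.adjoint φ f)
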